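/- Let $m\ge 1$, let $A=(a_{ij})\in\mathbb R^{m\times n}$ and let $\beta\in\mathbb R^n$ be a vector whose entries are not all equal (so $n\ge2$). Write $A_i$ and $A^j$ for the $i$-th row and the $j$-th column of $A$. Consider the polyhedra \[P=\{(y,\pi_1)\in\mathbb R^{n+1} : A_iy-\pi_1\le 0\ (1\le i\le m),\ y_j\ge 0\ (1\le j\le n),\ \textstyle\sum_j y_j=1\},\] \[Q'=\{(x,\lambda,\pi_2)\in\mathbb R^{m+2} : x_i\ge 0\ (1\le i\le m),\ -x^TA^j+\beta_j\lambda-\pi_2\le 0\ (1\le j\le n),\ \textstyle\sum_i x_i=1\}.\] In both, number the inequalities $1,\dots,m+n$ in the order $i=1,\dots,m$, then $j=1,\dots,n$, and let $L(\cdot)$ be the set of the indices of the inequalities that are tight at a point. Assume that $P$ and $Q'$ are non-degenerate: $|L(v)|\le n$ for all $v\in P$ and $|L(w)|\le m+1$ for all $w\in Q'$. Let \[\mathcal N=\{(v,w)\in P\times Q' : L(v)\cup L(w)=\{1,\dots,m+n\}\},\qquad \mathcal E_v=\{w : (v,w)\in\mathcal N\}.\] Call a homeomorphism $\varphi:\mathbb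 R\to\mathcal N$ a directed traversal of $\mathcal N$ if there are vertices $v_s=(y^s,\pi_1^s)$ and $v_e=(y^e,\pi_1^e)$ of $P$, with $y^s$ supported on the indices $j$ at which $\beta_j$ is minimal and $y^e$ supported on the indices at which $\beta_j$ is maximal, such that $\varphi(t)\in\{v_s\}\times\mathcal E_{v_s}$ for all $t$ close enough to $-\infty$ and $\varphi(t)\in\{v_e\}\times\mathcal E_{v_e}$ for all $t$ close enough to $+\infty$. Then $\mathcal N$ is a directed path, that is, it has a directed traversal. On the directed path $\mathcal N$, both $\beta^Ty$ and $\lambda$ increase monotonically (in the weak sense), and the function $g((y,\pi_1),(x,\lambda,\pi_2))=\beta^Ty+\lambda$ strictly increases from $-\infty$ to $\infty$. That is, for every directed traversal $\varphi$ the functions $(\beta^Ty)\circ\varphi$ and $\lambda\circ\varphi$ are non-decreasing, $g\circ\varphi$ is strictly increasing, and $g(\varphi(t))\to\pm\infty$ as $t\to\pm\infty$. Consequently $g:\mathcal N\to\mathbb R$ is a bijection. -/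

import Mathlib

open Filter

noncomputable section

namespace GameSpace

variable {m n : ℕ}

/-- The best response polytope `P` of the row player with payoff matrix `A`:
the points `(y, π₁)` with `A y ≤ π₁`, `y ≥ 0` and `∑ y = 1`. -/
def P (A : Matrix (Fin m) (Fin n) ℝ) : Set ((Fin n → ℝ) × ℝ) :=
  {v | (∀ i, A i ⬝ᵥ v.1 - v.2 ≤ 0) ∧ (∀ j, 0 ≤ v.1 j) ∧ ∑ j, v.1 j = 1}

/-- The polytope `Q'` of the game space `{(A, C + α βᵀ) | α}`:
the points `(x, λ, π₂)` with `x ≥ 0`, `xᵀ Cʲ + βⱼ λ ≤ π₂` and `∑ x = 1`. -/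
def Q' (C : Matrix (Fin m) (Fin n) ℝ) (β : Fin n → ℝ) : Set ((Fin m → ℝ) × ℝ × ℝ) :=
  {w | (∀ i, 0 ≤ w.1 i) ∧ (∀ j, w.1 ⬝ᵥ C.col j + β j * w.2.1 - w.2.2 ≤ 0) ∧ ∑ i, w.1 i = 1}

/-- The label of a point of `P`: the indices of the inequalities tight at it. The label set
`{1, …, m + n}` is `Fin m ⊕ Fin n`, the row indices coming first. -/
def labelP (A : Matrix (Fin m) (Fin n) ℝ) (v : (Fin n → ℝ) × ℝ) : Set (Fin m ⊕ Fin n) :=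
  Sum.inl '' {i | A i ⬝ᵥ v.1 - v.2 = 0} ∪ Sum.inr '' {j | v.1 j = 0}

/-- The label of a point of `Q'`: the indices of the inequalities tight at it. -/
def labelQ' (C : Matrix (Fin m) (Fin n) ℝ) (β : Fin n → ℝ) (w : (Fin m → ℝ) × ℝ × ℝ) :
    Set (Fin m ⊕ Fin n) :=
  Sum.inl '' {i | w.1 i = 0} ∪ Sum.inr '' {j | w.1 ⬝ᵥ C.col j + β j * w.2.1 - w.2.2 = 0}

/-- `P`, which has dimension `n`, is non-degenerate: no point has more than `n` labels. -/
def NondegenerateP (A : Matrix (Fin m) (Fin n) ℝ) : Prop :=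
  ∀ v ∈ P A, (labelP A v).ncard ≤ n

/-- `Q'`, which has dimension `m + 1`, is non-degenerate: no point has more than `m + 1` labels. -/
def NondegenerateQ' (C : Matrix (Fin m) (Fin n) ℝ) (β : Fin n → ℝ) : Prop :=
  ∀ w ∈ Q' C β, (labelQ' C β w).ncard ≤ m + 1

/-- The set `𝒩` of fully-labeled pairs of `P × Q'`. -/
def N (A C : Matrix (Fin m) (Fin n) ℝ) (β : Fin n → ℝ) :
    Set (((Fin n → ℝ) × ℝ) × ((Fin m → ℝ) × ℝ × ℝ)) :=
  {p | p.1 ∈ P A ∧ p.2 ∈ Q' C β ∧ labelP A p.1 ∪ labelQ' C β p.2 = Set.univ}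

/-- The set `ℰ_v` of the points of `Q'` that form a fully-labeled pair with `v`. -/
def E (A C : Matrix (Fin m) (Fin n) ℝ) (β : Fin n → ℝ) (v : (Fin n → ℝ) × ℝ) :
    Set ((Fin m → ℝ) × ℝ × ℝ) :=
  {w | (v, w) ∈ N A C β}

/-- `v` is a vertex of `P` whose `y`-part is supported on columns where `β` is minimal. If the
minimum is attained at `jₛ` only, then the only such vertex is `vₛ = (e_{jₛ}, max_i a_{i jₛ})`. -/
def IsStartVertex (A : Matrix (Fin m) (Fin n) ℝ) (β : Fin n → ℝ) (v : (Fin n → ℝ) × ℝ) : Prop :=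
  v ∈ Set.extremePoints ℝ (P A) ∧ ∀ j, v.1 j ≠ 0 → ∀ k, β j ≤ β k

/-- `v` is a vertex of `P` whose `y`-part is supported on columns where `β` is maximal
(the vertex `vₑ` if the maximum is attained only once). -/
def IsEndVertex (A : Matrix (Fin m) (Fin n) ℝ) (β : Fin n → ℝ) (v : (Fin n → ℝ) × ℝ) : Prop :=
  v ∈ Set.extremePoints ℝ (P A) ∧ ∀ j, v.1 j ≠ 0 → ∀ k, β k ≤ β j

/-- `φ` traverses the whole of `𝒩` as a directed path: it runs through every point of `𝒩` exactly
once, continuously with a continuous inverse, comes in along the unbounded edge `(vₛ, ℰ_{vₛ})` and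
goes out along the unbounded edge `(vₑ, ℰ_{vₑ})`. -/
def IsDirectedTraversal (A C : Matrix (Fin m) (Fin n) ℝ) (β : Fin n → ℝ)
    (φ : ℝ ≃ₜ N A C β) : Prop :=
  (∃ v, IsStartVertex A β v ∧
    ∀ᶠ t in atBot, (φ t : ((Fin n → ℝ) × ℝ) × ((Fin m → ℝ) × ℝ × ℝ)) ∈ {v} ×ˢ E A C β v) ∧
  (∃ v, IsEndVertex A β v ∧
    ∀ᶠ t in atTop, (φ t : ((Fin n → ℝ) × ℝ) × ((Fin m → ℝ) × ℝ × ℝ)) ∈ {v} ×ˢ E A C β v)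

/-- The coordinate function `βᵀ y` on `𝒩`. -/
def betaY (A C : Matrix (Fin m) (Fin n) ℝ) (β : Fin n → ℝ) (p : N A C β) : ℝ :=
  β ⬝ᵥ p.1.1.1

/-- The coordinate function `λ` on `𝒩`. -/
def lam (A C : Matrix (Fin m) (Fin n) ℝ) (β : Fin n → ℝ) (p : N A C β) : ℝ :=
  p.1.2.2.1

/-- The function `g = βᵀ y + λ` on `𝒩`. -/
def g (A C : Matrix (Fin m) (Fin n) ℝ) (β : Fin n → ℝ) (p : N A C β) : ℝ :=
  betaY A C β p + lam A C β p

end GameSpace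

end

/-! The slacks of `P` and `Q'` pair to the duality gap `π₁ + π₂ - λ βᵀy`, so the gap is nonnegative
on `P × Q'` and `𝒩` is its zero set (`mem_N_iff`). Adding the gap inequalities of the two crossed
pairs of `p, q ∈ 𝒩` shows that `βᵀy` and `λ` never move oppositely, so ordering points by `g` orders
both.

Hence equal values of `g` force equal `βᵀy` and `λ`; the midpoint then lies in `𝒩`, and
nondegeneracy there makes the points coincide (`g_injective`). A saddle point of `xᵀAy - s βᵀy +
(βᵀy)²/2` is a point with `g = s` (`g_surjective`). As `g` is also proper, its inverse is a
homeomorphism `ℝ → 𝒩`.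

For large `|g|` only columns with extremal `β` are tight, so `𝒩` runs along a ray over one vertex of
`P` (`exists_end_vertex`). Along any traversal `g` is a continuous bijection of `ℝ`, hence strictly
monotone, and the ends fix its direction. -/

open Filter

noncomputable section

namespace GameSpace

/-! ### Polyhedra in standard position -/

section Polyhedron

variable {ι V : Type*} [AddCommGroup V] [Module ℝ V]

/-- Moving along a ray inside a polyhedron until a new inequality becomes tight. -/
lemma exists_new_tight [Finite ι] {a c : ι → ℝ} (ha : ∀ k, a k ≤ 0)
    (h0 : ∀ k, a k = 0 → c k = 0) (hc : ∃ k, 0 < c k) :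
    ∃ t : ℝ, (∀ k, a k + t * c k ≤ 0) ∧ ∃ k, a k ≠ 0 ∧ a k + t * c k = 0 := by
  -- Ratio test: `k₀` is the first inequality hit along the ray.
  obtain ⟨k₀, hk₀, hmin⟩ :=
    (Set.toFinite {k | 0 < c k}).exists_minimalFor (fun k => -a k / c k) _ hc
  have hk₀ : 0 < c k₀ := hk₀
  have ht : 0 ≤ -a k₀ / c k₀ := div_nonneg (by linarith [ha k₀]) hk₀.le
  refine ⟨-a k₀ / c k₀, fun k => ?_, k₀, fun h => hk₀.ne' (h0 k₀ h), by field_simp; ring⟩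
  rcases le_or_gt (c k) 0 with hk | hk
  · nlinarith [ha k, mul_nonneg ht (neg_nonneg.2 hk)]
  · have hle : -a k₀ / c k₀ ≤ -a k / c k := by
      rcases le_total (-a k₀ / c k₀) (-a k / c k) with h | h
      · exact h
      · exact hmin hk h
    rw [le_div_iff₀ hk] at hle
    linarith

/-- At a point of a nondegenerate pointed polyhedron with the maximal number of tight
inequalities, no direction stays tight. -/
lemma eq_zero_of_tight [Finite ι] {Φ : V →ₗ[ℝ] ι → ℝ} {σ : V →ₗ[ℝ] ℝ} {D : ℕ}
    (hpt : ∀ e, σ e = 0 → Φ e = 0 → e = 0)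
    (hnd : ∀ v, (∀ k, Φ v k ≤ 0) → σ v = 1 → {k | Φ v k = 0}.ncard ≤ D)
    {v : V} (hv : ∀ k, Φ v k ≤ 0) (hσ : σ v = 1) (hD : D ≤ {k | Φ v k = 0}.ncard)
    {e : V} (he : σ e = 0) (het : ∀ k, Φ v k = 0 → Φ e k = 0) : e = 0 := by
  -- If some slack grew along `e`, following `e` would reach a point with more than `D` tight
  -- inequalities. Applied to `e` and `-e`, this kills all slacks.
  have key : ∀ e, σ e = 0 → (∀ k, Φ v k = 0 → Φ e k = 0) → ∀ k, Φ e k ≤ 0 := by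
    intro e he het
    by_contra! hc
    obtain ⟨t, ht, k₀, hk₀, hk₀'⟩ := exists_new_tight hv het hc
    have hval : ∀ k, Φ (v + t • e) k = Φ v k + t * Φ e k := fun k => by simp
    have hlt : {k | Φ v k = 0} ⊂ {k | Φ (v + t • e) k = 0} := by
      refine (Set.ssubset_iff_of_subset fun k hk => ?_).2 ⟨k₀, ?_, hk₀⟩
      · have hk : Φ v k = 0 := hk
        simp only [Set.mem_ofPred_eq, hval, hk, het k hk, mul_zero, add_zero]
      · simpa only [Set.mem_ofPred_eq, hval] using hk₀'
    have h1 := Set.ncard_lt_ncard hlt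
    have h2 := hnd (v + t • e) (fun k => by rw [hval]; exact ht k) (by simp [hσ, he])
    omega
  refine hpt e he (funext fun k => le_antisymm (key e he het k) ?_)
  have := key (-e) (by simp [he]) (fun k hk => by simp [het k hk]) k
  simpa using this

/-- At a point of a nondegenerate pointed polyhedron with the maximal number of tight
inequalities, the tight functionals take arbitrary values. -/
lemma exists_of_tight [Finite ι] [FiniteDimensional ℝ V] {Φ : V →ₗ[ℝ] ι → ℝ} {σ : V →ₗ[ℝ] ℝ}
    {D : ℕ} (hdim : Module.finrank ℝ V = D + 1)
    (hpt : ∀ e, σ e = 0 → Φ e = 0 → e = 0)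
    (hnd : ∀ v, (∀ k, Φ v k ≤ 0) → σ v = 1 → {k | Φ v k = 0}.ncard ≤ D)
    {v : V} (hv : ∀ k, Φ v k ≤ 0) (hσ : σ v = 1) (hD : D ≤ {k | Φ v k = 0}.ncard)
    (c : ι → ℝ) : ∃ e, σ e = 0 ∧ ∀ k, Φ v k = 0 → Φ e k = c k := by
  classical
  have := Fintype.ofFinite ι
  let T : V →ₗ[ℝ] ({k // Φ v k = 0} → ℝ) × ℝ :=
    ((LinearMap.funLeft ℝ ℝ Subtype.val).comp Φ).prod σ
  have hT : Function.Injective T := by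
    rw [injective_iff_map_eq_zero]
    intro e he
    have h1 : ∀ k : {k // Φ v k = 0}, Φ e k = 0 := fun k => congrFun (congrArg Prod.fst he) k
    exact eq_zero_of_tight hpt hnd hv hσ hD (congrArg Prod.snd he) fun k hk => h1 ⟨k, hk⟩
  have hcard : {k | Φ v k = 0}.ncard = Fintype.card {k // Φ v k = 0} := by
    rw [← Nat.card_eq_fintype_card]; rfl
  have hfr : Module.finrank ℝ V = Module.finrank ℝ (({k // Φ v k = 0} → ℝ) × ℝ) := by
    have := hnd v hv hσ
    rw [Module.finrank_prod, Module.finrank_fintype_fun_eq_card, Module.finrank_self, hdim]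
    omega
  obtain ⟨e, he⟩ := (LinearMap.injective_iff_surjective_of_finrank_eq_finrank hfr).1 hT
    (fun k => c k, 0)
  exact ⟨e, congrArg Prod.snd he, fun k hk => congrFun (congrArg Prod.fst he) ⟨k, hk⟩⟩

/-- A point of a nondegenerate pointed polyhedron with the maximal number of tight inequalities
is a vertex. -/
lemma mem_extremePoints_of_tight [Finite ι] {Φ : V →ₗ[ℝ] ι → ℝ} {σ : V →ₗ[ℝ] ℝ} {D : ℕ}
    (hpt : ∀ e, σ e = 0 → Φ e = 0 → e = 0)
    (hnd : ∀ v, (∀ k, Φ v k ≤ 0) → σ v = 1 → {k | Φ v k = 0}.ncard ≤ D)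
    {v : V} (hv : ∀ k, Φ v k ≤ 0) (hσ : σ v = 1) (hD : D ≤ {k | Φ v k = 0}.ncard) :
    v ∈ Set.extremePoints ℝ {v | (∀ k, Φ v k ≤ 0) ∧ σ v = 1} := by
  refine ⟨⟨hv, hσ⟩, ?_⟩
  rintro v₁ ⟨h₁, hσ₁⟩ v₂ ⟨h₂, hσ₂⟩ ⟨a, b, ha, hb, hab, rfl⟩
  have : v₁ - v₂ = 0 := by
    refine eq_zero_of_tight hpt hnd hv hσ hD (by simp [hσ₁, hσ₂]) fun k hk => ?_
    have hk : a * Φ v₁ k + b * Φ v₂ k = 0 := by simpa using hk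
    have e1 : Φ v₁ k = 0 := by nlinarith [h₁ k, h₂ k]
    have e2 : Φ v₂ k = 0 := by nlinarith [h₁ k, h₂ k]
    simp [e1, e2]
  rw [← sub_eq_zero.1 this, ← add_smul, hab, one_smul]

end Polyhedron

/-! ### The two polyhedra of the game space -/

variable {m n : ℕ}

/-- The linear forms of the inequalities of `P`, in the form `slackP A v k ≤ 0`. -/
def slackP (A : Matrix (Fin m) (Fin n) ℝ) : ((Fin n → ℝ) × ℝ) →ₗ[ℝ] Fin m ⊕ Fin n → ℝ where
  toFun v := Sum.elim (fun i => A i ⬝ᵥ v.1 - v.2) (fun j => -v.1 j)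
  map_add' v w := by
    ext (i | j)
    · simp only [Sum.elim_inl, Pi.add_apply, Prod.fst_add, Prod.snd_add, dotProduct_add]; ring
    · simp only [Sum.elim_inr, Pi.add_apply, Prod.fst_add]; ring
  map_smul' c v := by
    ext (i | j)
    · simp only [Sum.elim_inl, Pi.smul_apply, Prod.smul_fst, Prod.smul_snd, dotProduct_smul,
        smul_eq_mul, RingHom.id_apply]; ring
    · simp

/-- The linear forms of the inequalities of `Q'`, in the form `slackQ' C β w k ≤ 0`. -/
def slackQ' (C : Matrix (Fin m) (Fin n) ℝ) (β : Fin n → ℝ) :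
    ((Fin m → ℝ) × ℝ × ℝ) →ₗ[ℝ] Fin m ⊕ Fin n → ℝ where
  toFun w := Sum.elim (fun i => -w.1 i) (fun j => w.1 ⬝ᵥ C.col j + β j * w.2.1 - w.2.2)
  map_add' v w := by
    ext (i | j)
    · simp only [Sum.elim_inl, Pi.add_apply, Prod.fst_add]; ring
    · simp only [Sum.elim_inr, Pi.add_apply, Prod.fst_add, Prod.snd_add, add_dotProduct]; ring
  map_smul' c v := by
    ext (i | j)
    · simp
    · simp only [Sum.elim_inr, Pi.smul_apply, Prod.smul_fst, Prod.smul_snd, smul_dotProduct,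
        smul_eq_mul, RingHom.id_apply]; ring

/-- The sum of the coordinates of the strategy part. -/
def total (k : ℕ) (F : Type*) [AddCommGroup F] [Module ℝ F] : ((Fin k → ℝ) × F) →ₗ[ℝ] ℝ :=
  (∑ j, LinearMap.proj j).comp (LinearMap.fst ℝ _ _)

lemma total_apply {k : ℕ} {F : Type*} [AddCommGroup F] [Module ℝ F] (v : (Fin k → ℝ) × F) :
    total k F v = ∑ j, v.1 j := by simp [total]

lemma mem_P_iff {A : Matrix (Fin m) (Fin n) ℝ} {v : (Fin n → ℝ) × ℝ} :
    v ∈ P A ↔ (∀ k, slackP A v k ≤ 0) ∧ total n ℝ v = 1 := by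
  simp [P, slackP, total_apply, Sum.forall, and_assoc]

lemma mem_Q'_iff {C : Matrix (Fin m) (Fin n) ℝ} {β : Fin n → ℝ} {w : (Fin m → ℝ) × ℝ × ℝ} :
    w ∈ Q' C β ↔ (∀ k, slackQ' C β w k ≤ 0) ∧ total m (ℝ × ℝ) w = 1 := by
  simp [Q', slackQ', total_apply, Sum.forall, and_assoc]

lemma labelP_eq (A : Matrix (Fin m) (Fin n) ℝ) (v : (Fin n → ℝ) × ℝ) :
    labelP A v = {k | slackP A v k = 0} := by
  ext (i | j) <;> simp [labelP, slackP]

lemma labelQ'_eq (C : Matrix (Fin m) (Fin n) ℝ) (β : Fin n → ℝ) (w : (Fin m → ℝ) × ℝ × ℝ) :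
    labelQ' C β w = {k | slackQ' C β w k = 0} := by
  ext (i | j) <;> simp [labelQ', slackQ']

lemma slackP_pointed (hm : 0 < m) (A : Matrix (Fin m) (Fin n) ℝ) (v : (Fin n → ℝ) × ℝ)
    (h : slackP A v = 0) : v = 0 := by
  have h1 : v.1 = 0 := funext fun j => by simpa [slackP] using congrFun h (Sum.inr j)
  have h2 : v.2 = 0 := by simpa [slackP, h1] using congrFun h (Sum.inl ⟨0, hm⟩)
  exact Prod.ext h1 h2

/-- Two columns with different `β` force `λ = 0`, so nonconstancy of `β` excludes lines in `Q'`. -/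
lemma slackQ'_pointed {β : Fin n → ℝ} (hβ : ∃ j k, β j ≠ β k) (C : Matrix (Fin m) (Fin n) ℝ)
    (w : (Fin m → ℝ) × ℝ × ℝ) (h : slackQ' C β w = 0) : w = 0 := by
  obtain ⟨j, k, hjk⟩ := hβ
  have h1 : w.1 = 0 := funext fun i => by simpa [slackQ'] using congrFun h (Sum.inl i)
  have hj : β j * w.2.1 - w.2.2 = 0 := by simpa [slackQ', h1] using congrFun h (Sum.inr j)
  have hk : β k * w.2.1 - w.2.2 = 0 := by simpa [slackQ', h1] using congrFun h (Sum.inr k)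
  have h2 : w.2.1 = 0 := by
    have : (β j - β k) * w.2.1 = 0 := by linarith
    exact (mul_eq_zero.1 this).resolve_left (sub_ne_zero.2 hjk)
  have h3 : w.2.2 = 0 := by rw [h2] at hj; linarith
  exact Prod.ext h1 (Prod.ext h2 h3)

/-- The slacks of `P` and of `Q'` (for the zero-sum game `(A, -A)`) pair to the duality gap. -/
lemma sum_slackP_mul_slackQ' (A : Matrix (Fin m) (Fin n) ℝ) (β : Fin n → ℝ)
    (v : (Fin n → ℝ) × ℝ) (w : (Fin m → ℝ) × ℝ × ℝ) :
    ∑ k, slackP A v k * slackQ' (-A) β w k =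
      v.2 * total m (ℝ × ℝ) w + w.2.2 * total n ℝ v - w.2.1 * (β ⬝ᵥ v.1) := by
  have hswap : ∑ i, A i ⬝ᵥ v.1 * w.1 i = ∑ j, v.1 j * (w.1 ⬝ᵥ A.col j) := by
    simp only [dotProduct, Finset.mul_sum, Finset.sum_mul, Matrix.col_apply]
    rw [Finset.sum_comm]
    exact Finset.sum_congr rfl fun _ _ => Finset.sum_congr rfl fun _ _ => by ring
  have hneg : ∀ j, w.1 ⬝ᵥ (-A).col j = -(w.1 ⬝ᵥ A.col j) := fun j => by
    simp [dotProduct, Matrix.col_apply]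
  have e1 : ∑ i, (A i ⬝ᵥ v.1 - v.2) * -w.1 i = v.2 * ∑ i, w.1 i - ∑ i, A i ⬝ᵥ v.1 * w.1 i := by
    rw [Finset.mul_sum, ← Finset.sum_sub_distrib]
    exact Finset.sum_congr rfl fun _ _ => by ring
  have e2 : ∑ j, -v.1 j * (-(w.1 ⬝ᵥ A.col j) + β j * w.2.1 - w.2.2) =
      ∑ j, v.1 j * (w.1 ⬝ᵥ A.col j) + w.2.2 * ∑ j, v.1 j - w.2.1 * (β ⬝ᵥ v.1) := by
    rw [dotProduct, Finset.mul_sum, Finset.mul_sum, ← Finset.sum_add_distrib,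
      ← Finset.sum_sub_distrib]
    exact Finset.sum_congr rfl fun _ _ => by ring
  simp only [Fintype.sum_sum_type, slackP, slackQ', LinearMap.coe_mk, AddHom.coe_mk,
    Sum.elim_inl, Sum.elim_inr, total_apply, hneg, e1, e2]
  linarith [hswap]

variable {A : Matrix (Fin m) (Fin n) ℝ} {β : Fin n → ℝ}

lemma lam_mul_le {v : (Fin n → ℝ) × ℝ} {w : (Fin m → ℝ) × ℝ × ℝ} (hv : v ∈ P A)
    (hw : w ∈ Q' (-A) β) : w.2.1 * (β ⬝ᵥ v.1) ≤ v.2 + w.2.2 := by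
  have h := sum_slackP_mul_slackQ' A β v w
  rw [mem_P_iff] at hv
  rw [mem_Q'_iff] at hw
  have : 0 ≤ ∑ k, slackP A v k * slackQ' (-A) β w k :=
    Finset.sum_nonneg fun k _ => mul_nonneg_of_nonpos_of_nonpos (hv.1 k) (hw.1 k)
  rw [hv.2, hw.2] at h
  linarith

/-- Complementary slackness: the gap is a sum of products of nonpositive slacks, so it vanishes
exactly when each index is tight on one side. -/
lemma mem_N_iff {p : ((Fin n → ℝ) × ℝ) × ((Fin m → ℝ) × ℝ × ℝ)} :
    p ∈ N A (-A) β ↔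
      p.1 ∈ P A ∧ p.2 ∈ Q' (-A) β ∧ p.1.2 + p.2.2.2 = p.2.2.1 * (β ⬝ᵥ p.1.1) := by
  simp only [N, Set.mem_ofPred_eq]
  refine and_congr_right fun hv => and_congr_right fun hw => ?_
  have h := sum_slackP_mul_slackQ' A β p.1 p.2
  rw [mem_P_iff] at hv
  rw [mem_Q'_iff] at hw
  rw [hv.2, hw.2] at h
  have hz : p.1.2 + p.2.2.2 = p.2.2.1 * (β ⬝ᵥ p.1.1) ↔
      ∑ k, slackP A p.1 k * slackQ' (-A) β p.2 k = 0 := by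
    constructor <;> intro h' <;> linarith
  rw [hz, Finset.sum_eq_zero_iff_of_nonneg fun k _ =>
    mul_nonneg_of_nonpos_of_nonpos (hv.1 k) (hw.1 k), labelP_eq, labelQ'_eq,
    Set.eq_univ_iff_forall]
  simp

lemma slack_eq_zero_or {p : ((Fin n → ℝ) × ℝ) × ((Fin m → ℝ) × ℝ × ℝ)} (hp : p ∈ N A (-A) β)
    (k : Fin m ⊕ Fin n) : slackP A p.1 k = 0 ∨ slackQ' (-A) β p.2 k = 0 := by
  have := hp.2.2
  rw [labelP_eq, labelQ'_eq] at this
  exact Set.eq_univ_iff_forall.1 this k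

/-- On `𝒩`, the coordinates `βᵀ y` and `λ` never move in opposite directions. -/
lemma betaY_lam_monovary (p q : N A (-A) β) :
    0 ≤ (lam A (-A) β q - lam A (-A) β p) * (betaY A (-A) β q - betaY A (-A) β p) := by
  obtain ⟨hp1, hp2, hp⟩ := mem_N_iff.1 p.2
  obtain ⟨hq1, hq2, hq⟩ := mem_N_iff.1 q.2
  -- Weak duality for the two crossed pairs; their sum is the claim.
  have h1 := lam_mul_le hp1 hq2
  have h2 := lam_mul_le hq1 hp2
  simp only [lam, betaY]
  nlinarith

lemma betaY_le_and_lam_le_of_g_le {p q : N A (-A) β} (h : g A (-A) β p ≤ g A (-A) β q) :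
    betaY A (-A) β p ≤ betaY A (-A) β q ∧ lam A (-A) β p ≤ lam A (-A) β q := by
  have hm := betaY_lam_monovary p q
  simp only [g] at h
  constructor
  · by_contra! hlt
    nlinarith
  · by_contra! hlt
    nlinarith

/-! ### Injectivity of `g` -/

/-- At most `n - 1` and `m` labels could not cover all `m + n`. -/
lemma card_label_cases (hP : NondegenerateP A) (hQ : NondegenerateQ' (-A) β)
    {p : ((Fin n → ℝ) × ℝ) × ((Fin m → ℝ) × ℝ × ℝ)} (hp : p ∈ N A (-A) β) :
    n ≤ {k | slackP A p.1 k = 0}.ncard ∨ m + 1 ≤ {k | slackQ' (-A) β p.2 k = 0}.ncard := by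
  have h1 := hP p.1 hp.1
  have h2 := hQ p.2 hp.2.1
  have h3 := Set.ncard_union_le (labelP A p.1) (labelQ' (-A) β p.2)
  rw [hp.2.2, Set.ncard_univ, Nat.card_eq_fintype_card, Fintype.card_sum, Fintype.card_fin,
    Fintype.card_fin] at h3
  rw [← labelP_eq, ← labelQ'_eq]
  omega

lemma NondegenerateP.ncard_le (hP : NondegenerateP A) (v : (Fin n → ℝ) × ℝ)
    (hv : ∀ k, slackP A v k ≤ 0) (hσ : total n ℝ v = 1) : {k | slackP A v k = 0}.ncard ≤ n := by
  rw [← labelP_eq]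
  exact hP v (mem_P_iff.2 ⟨hv, hσ⟩)

lemma NondegenerateQ'.ncard_le (hQ : NondegenerateQ' (-A) β) (w : (Fin m → ℝ) × ℝ × ℝ)
    (hw : ∀ k, slackQ' (-A) β w k ≤ 0) (hσ : total m (ℝ × ℝ) w = 1) :
    {k | slackQ' (-A) β w k = 0}.ncard ≤ m + 1 := by
  rw [← labelQ'_eq]
  exact hQ w (mem_Q'_iff.2 ⟨hw, hσ⟩)

/-- The hypothesis turns the sum into `∑ k, b k * b k`. -/
lemma eq_zero_of_sum_mul_eq_zero {ι : Type*} [Fintype ι] {a b : ι → ℝ}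
    (hab : ∀ k, a k = b k ∨ b k = 0) (h : ∑ k, a k * b k = 0) : b = 0 := by
  have h' : ∀ k, a k * b k = b k * b k := fun k => by
    rcases hab k with h | h <;> simp [h]
  simp only [h'] at h
  rw [Finset.sum_eq_zero_iff_of_nonneg fun k _ => mul_self_nonneg _] at h
  exact funext fun k => mul_self_eq_zero.1 (h k (Finset.mem_univ k))

theorem g_injective (hm : 0 < m) (hβ : ∃ j k, β j ≠ β k) (hP : NondegenerateP A)
    (hQ : NondegenerateQ' (-A) β) : Function.Injective (g A (-A) β) := by
  intro p q hpq
  have hb : β ⬝ᵥ p.1.1.1 = β ⬝ᵥ q.1.1.1 := le_antisymm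
    (betaY_le_and_lam_le_of_g_le hpq.le).1 (betaY_le_and_lam_le_of_g_le hpq.ge).1
  have hl : p.1.2.2.1 = q.1.2.2.1 := le_antisymm
    (betaY_le_and_lam_le_of_g_le hpq.le).2 (betaY_le_and_lam_le_of_g_le hpq.ge).2
  obtain ⟨⟨v, w⟩, hp⟩ := p
  obtain ⟨⟨v', w'⟩, hq⟩ := q
  obtain ⟨hv, hw, hvw⟩ := mem_N_iff.1 hp
  obtain ⟨hv', hw', hvw'⟩ := mem_N_iff.1 hq
  simp only [mem_P_iff, mem_Q'_iff] at hb hl hv hw hvw hv' hw' hvw'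
  set v'' : (Fin n → ℝ) × ℝ := (1 / 2 : ℝ) • (v + v') with hv''
  set w'' : (Fin m → ℝ) × ℝ × ℝ := (1 / 2 : ℝ) • (w + w') with hw''
  have eP : ∀ k, slackP A v'' k = 1 / 2 * (slackP A v k + slackP A v' k) := fun k => by
    rw [hv'', map_smul, map_add]; rfl
  have eQ : ∀ k, slackQ' (-A) β w'' k =
      1 / 2 * (slackQ' (-A) β w k + slackQ' (-A) β w' k) := fun k => by
    rw [hw'', map_smul, map_add]; rfl
  have hPv : ∀ k, slackP A v'' k ≤ 0 := fun k => by rw [eP]; linarith [hv.1 k, hv'.1 k]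
  have hQw : ∀ k, slackQ' (-A) β w'' k ≤ 0 := fun k => by rw [eQ]; linarith [hw.1 k, hw'.1 k]
  have hσv : total n ℝ v'' = 1 := by
    rw [hv'', map_smul, map_add, hv.2, hv'.2]; norm_num
  have hσw : total m (ℝ × ℝ) w'' = 1 := by
    rw [hw'', map_smul, map_add, hw.2, hw'.2]; norm_num
  -- With `βᵀy` and `λ` shared, the gap is affine on the segment, so it vanishes at the midpoint.
  have hN : (v'', w'') ∈ N A (-A) β := by
    refine mem_N_iff.2 ⟨mem_P_iff.2 ⟨hPv, hσv⟩, mem_Q'_iff.2 ⟨hQw, hσw⟩, ?_⟩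
    simp only [hv'', hw'', Prod.smul_fst, Prod.smul_snd, Prod.fst_add, Prod.snd_add,
      dotProduct_smul, dotProduct_add, smul_eq_mul, ← hb, ← hl]
    rw [← hb, ← hl] at hvw'
    linarith
  have tP : ∀ k, slackP A v'' k = 0 → slackP A (v - v') k = 0 := fun k hk => by
    rw [eP] at hk
    have h1 : slackP A v k = 0 := by linarith [hv.1 k, hv'.1 k]
    have h2 : slackP A v' k = 0 := by linarith [hv.1 k, hv'.1 k]
    rw [map_sub, Pi.sub_apply, h1, h2, sub_zero]
  have tQ : ∀ k, slackQ' (-A) β w'' k = 0 → slackQ' (-A) β (w - w') k = 0 := fun k hk => by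
    rw [eQ] at hk
    have h1 : slackQ' (-A) β w k = 0 := by linarith [hw.1 k, hw'.1 k]
    have h2 : slackQ' (-A) β w' k = 0 := by linarith [hw.1 k, hw'.1 k]
    rw [map_sub, Pi.sub_apply, h1, h2, sub_zero]
  have σP : total n ℝ (v - v') = 0 := by rw [map_sub, hv.2, hv'.2, sub_self]
  have σQ : total m (ℝ × ℝ) (w - w') = 0 := by rw [map_sub, hw.2, hw'.2, sub_self]
  have ptP : ∀ e, total n ℝ e = 0 → slackP A e = 0 → e = 0 := fun e _ => slackP_pointed hm A e
  have ptQ : ∀ e, total m (ℝ × ℝ) e = 0 → slackQ' (-A) β e = 0 → e = 0 :=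
    fun e _ => slackQ'_pointed hβ (-A) e
  have hvw0 : v - v' = 0 ∧ w - w' = 0 := by
    rcases card_label_cases hP hQ hN with h | h
    · refine ⟨eq_zero_of_tight ptP hP.ncard_le hPv hσv h σP tP, ptQ _ σQ ?_⟩
      -- The `P`-component is settled. A direction `e` whose slacks copy those of `w - w'` on the
      -- tight set of `v''` pairs with `w - w'` to a sum of squares; the pairing is zero because the
      -- totals and the change of `λ` vanish.
      obtain ⟨e, he, hek⟩ := exists_of_tight (by simp) ptP hP.ncard_le hPv hσv h
        (slackQ' (-A) β (w - w'))
      refine eq_zero_of_sum_mul_eq_zero (a := slackP A e)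
        (fun k => (slack_eq_zero_or hN k).imp (hek k) (tQ k)) ?_
      rw [sum_slackP_mul_slackQ', he, σQ]
      simp [hl]
    · refine ⟨ptP _ σP ?_, eq_zero_of_tight ptQ hQ.ncard_le hQw hσw h σQ tQ⟩
      obtain ⟨e, he, hek⟩ := exists_of_tight (by simp) ptQ hQ.ncard_le hQw hσw h
        (slackP A (v - v'))
      refine eq_zero_of_sum_mul_eq_zero (a := slackQ' (-A) β e)
        (fun k => (slack_eq_zero_or hN k).symm.imp (hek k) (tP k)) ?_
      simp only [mul_comm (slackQ' (-A) β e _)]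
      rw [sum_slackP_mul_slackQ', he, σP, Prod.fst_sub, dotProduct_sub, hb]
      simp
  exact Subtype.ext (Prod.ext (sub_eq_zero.1 hvw0.1) (sub_eq_zero.1 hvw0.2))

/-! ### Surjectivity of `g` -/

lemma nonneg_of_forall_add_mul_nonneg {D E : ℝ} (h : ∀ t, 0 < t → t ≤ 1 → 0 ≤ D + t * E) :
    0 ≤ D := by
  have ht : Tendsto (fun t : ℝ => D + t * E) (nhdsWithin 0 (Set.Ioi 0)) (nhds D) := by
    have : Continuous fun t : ℝ => D + t * E := by fun_prop
    simpa using (this.tendsto 0).mono_left nhdsWithin_le_nhds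
  refine ge_of_tendsto ht ?_
  filter_upwards [Ioo_mem_nhdsGT (zero_lt_one (α := ℝ))] with t ht
  exact h t ht.1 ht.2.le

/-- A saddle point of the bilinear form of `A` perturbed by a convex function of `βᵀ y`. -/
lemma exists_saddle (hm : 0 < m) (hn : 0 < n) (A : Matrix (Fin m) (Fin n) ℝ) (β : Fin n → ℝ)
    (s : ℝ) : ∃ y ∈ stdSimplex ℝ (Fin n), ∃ x ∈ stdSimplex ℝ (Fin m),
      IsSaddlePointOn (stdSimplex ℝ (Fin n)) (stdSimplex ℝ (Fin m))
        (fun y x => x ⬝ᵥ A.mulVec y - s * (β ⬝ᵥ y) + (β ⬝ᵥ y) ^ 2 / 2) y x := by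
  refine Sion.exists_isSaddlePointOn (f := fun y x =>
      x ⬝ᵥ A.mulVec y - s * (β ⬝ᵥ y) + (β ⬝ᵥ y) ^ 2 / 2)
    ⟨_, single_mem_stdSimplex ℝ (⟨0, hn⟩ : Fin n)⟩
    (convex_stdSimplex ℝ _) (isCompact_stdSimplex ℝ _) (fun x _ => ?_) (fun x _ => ?_)
    (convex_stdSimplex ℝ _) ⟨_, single_mem_stdSimplex ℝ (⟨0, hm⟩ : Fin m)⟩
    (isCompact_stdSimplex ℝ _) (fun y _ => ?_) (fun y _ => ?_)
  · refine (Continuous.lowerSemicontinuous ?_).lowerSemicontinuousOn _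
    simp only [dotProduct, Matrix.mulVec]
    fun_prop
  · refine ConvexOn.quasiconvexOn ⟨convex_stdSimplex ℝ _, fun y _ y' _ a b ha hb hab => ?_⟩
    simp only [Matrix.mulVec_add, Matrix.mulVec_smul, dotProduct_add, dotProduct_smul,
      smul_eq_mul]
    obtain rfl : b = 1 - a := by linarith
    nlinarith [mul_nonneg (mul_nonneg ha hb) (sq_nonneg (β ⬝ᵥ y - β ⬝ᵥ y'))]
  · refine (Continuous.upperSemicontinuous ?_).upperSemicontinuousOn _
    simp only [dotProduct]
    fun_prop
  · refine ConcaveOn.quasiconcaveOn ⟨convex_stdSimplex ℝ _, fun x _ x' _ a b ha hb hab => ?_⟩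
    simp only [add_dotProduct, smul_dotProduct, smul_eq_mul]
    obtain rfl : b = 1 - a := by linarith
    linarith

theorem g_surjective (hm : 0 < m) (hn : 0 < n) : Function.Surjective (g A (-A) β) := by
  intro s
  obtain ⟨y, hy, x, hx, hs⟩ := exists_saddle hm hn A β s
  set r : ℝ := x ⬝ᵥ A.mulVec y with hr
  set b : ℝ := β ⬝ᵥ y with hb
  -- `g = s` dictates `λ = s - b`, and zero gap dictates `π₂`. Optimality of `x` gives the rows,
  -- optimality of `y` the columns.
  have hN : ((y, r), (x, s - b, (s - b) * b - r)) ∈ N A (-A) β := by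
    refine mem_N_iff.2 ⟨⟨fun i => ?_, hy.1, hy.2⟩, ⟨hx.1, fun j => ?_, hx.2⟩, ?_⟩
    · have h := hs y hy (Pi.single i 1) (single_mem_stdSimplex ℝ i)
      simp only [single_dotProduct, one_mul] at h
      have h' : A i ⬝ᵥ y - s * b + b ^ 2 / 2 ≤ r - s * b + b ^ 2 / 2 := h
      show A i ⬝ᵥ y - r ≤ 0
      linarith
    · have hcol : x ⬝ᵥ A.mulVec (Pi.single j 1) = x ⬝ᵥ A.col j := by
        simp
      have hneg : x ⬝ᵥ (-A).col j = -(x ⬝ᵥ A.col j) := by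
        simp [dotProduct, Matrix.col_apply]
      have hβj : β ⬝ᵥ Pi.single j 1 = β j := by simp
      -- The directional derivative at `y` towards the vertex `e_j`; `E` below is the second-order
      -- term of the quadratic.
      have key : 0 ≤ (x ⬝ᵥ A.col j - r) - (s - b) * (β j - b) := by
        refine nonneg_of_forall_add_mul_nonneg (E := (β j - b) ^ 2 / 2) fun t ht ht1 => ?_
        have h := hs ((1 - t) • y + t • Pi.single j 1)
          (convex_stdSimplex ℝ _ hy (single_mem_stdSimplex ℝ j) (by linarith) ht.le (by ring)) x hx
        simp only [Matrix.mulVec_add, Matrix.mulVec_smul, dotProduct_add, dotProduct_smul,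
          smul_eq_mul, hcol, hβj, ← hr, ← hb] at h
        refine nonneg_of_mul_nonneg_right (a := t) ?_ ht
        nlinarith
      show x ⬝ᵥ (-A).col j + β j * (s - b) - ((s - b) * b - r) ≤ 0
      rw [hneg]
      nlinarith
    · show r + ((s - b) * b - r) = (s - b) * b
      ring
  refine ⟨⟨_, hN⟩, ?_⟩
  simp only [g, betaY, lam]
  ring

/-! ### The parametrization of `𝒩` by `g` -/

lemma continuous_g : Continuous (g A (-A) β) := by
  unfold g betaY lam
  simp only [dotProduct]
  fun_prop

lemma isClosed_N : IsClosed (N A (-A) β) := by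
  have : N A (-A) β = {p | (∀ i, A i ⬝ᵥ p.1.1 - p.1.2 ≤ 0) ∧ (∀ j, 0 ≤ p.1.1 j) ∧
      ∑ j, p.1.1 j = 1 ∧ (∀ i, 0 ≤ p.2.1 i) ∧
      (∀ j, p.2.1 ⬝ᵥ (-A).col j + β j * p.2.2.1 - p.2.2.2 ≤ 0) ∧ ∑ i, p.2.1 i = 1 ∧
      p.1.2 + p.2.2.2 = p.2.2.1 * (β ⬝ᵥ p.1.1)} := by
    ext p
    rw [mem_N_iff]
    simp only [P, Q', Set.mem_ofPred_eq]
    tauto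
  rw [this]
  simp only [dotProduct, Set.ofPred_and, Set.ofPred_forall]
  refine IsClosed.inter (isClosed_iInter fun _ => isClosed_le (by fun_prop) (by fun_prop)) <|
    IsClosed.inter (isClosed_iInter fun _ => isClosed_le (by fun_prop) (by fun_prop)) <|
    IsClosed.inter (isClosed_eq (by fun_prop) (by fun_prop)) <|
    IsClosed.inter (isClosed_iInter fun _ => isClosed_le (by fun_prop) (by fun_prop)) <|
    IsClosed.inter (isClosed_iInter fun _ => isClosed_le (by fun_prop) (by fun_prop)) <|
    IsClosed.inter (isClosed_eq (by fun_prop) (by fun_prop))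
    (isClosed_eq (by fun_prop) (by fun_prop))

/-- The point of `𝒩` with strategies `y`, `x` and with `g`-value `s`, if there is one. -/
def ofStrategies (A : Matrix (Fin m) (Fin n) ℝ) (β : Fin n → ℝ)
    (q : (Fin n → ℝ) × (Fin m → ℝ) × ℝ) : ((Fin n → ℝ) × ℝ) × ((Fin m → ℝ) × ℝ × ℝ) :=
  ((q.1, q.2.1 ⬝ᵥ A.mulVec q.1), (q.2.1, q.2.2 - β ⬝ᵥ q.1,
    (q.2.2 - β ⬝ᵥ q.1) * (β ⬝ᵥ q.1) - q.2.1 ⬝ᵥ A.mulVec q.1))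

lemma continuous_ofStrategies : Continuous (ofStrategies A β) := by
  unfold ofStrategies
  simp only [dotProduct, Matrix.mulVec]
  fun_prop

lemma value_eq {p : ((Fin n → ℝ) × ℝ) × ((Fin m → ℝ) × ℝ × ℝ)} (hp : p ∈ N A (-A) β) :
    p.1.2 = p.2.1 ⬝ᵥ A.mulVec p.1.1 := by
  have h : ∀ i, p.2.1 i * A.mulVec p.1.1 i = p.2.1 i * p.1.2 := fun i => by
    rcases slack_eq_zero_or hp (Sum.inl i) with h | h
    · have h : A.mulVec p.1.1 i - p.1.2 = 0 := h
      rw [sub_eq_zero.1 h]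
    · have h : -p.2.1 i = 0 := h
      rw [neg_eq_zero.1 h, zero_mul, zero_mul]
  rw [dotProduct, Finset.sum_congr rfl fun i _ => h i, ← Finset.sum_mul, hp.2.1.2.2, one_mul]

lemma ofStrategies_eq (p : N A (-A) β) :
    ofStrategies A β (p.1.1.1, p.1.2.1, g A (-A) β p) = p := by
  have h := (mem_N_iff.1 p.2).2.2
  have hv := value_eq p.2
  have e1 : g A (-A) β p - β ⬝ᵥ p.1.1.1 = p.1.2.2.1 := by simp [g, betaY, lam]
  simp only [ofStrategies, e1, ← hv, ← h]
  ext <;> simp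

/-- The strategies range over compact simplices and, together with `g`, determine the point
continuously. -/
lemma isProperMap_g : IsProperMap (g A (-A) β) := by
  refine isProperMap_iff_isCompact_preimage.2 ⟨continuous_g, fun K hK => ?_⟩
  rw [Subtype.isCompact_iff]
  have hc : IsCompact (ofStrategies A β ''
      (stdSimplex ℝ (Fin n) ×ˢ stdSimplex ℝ (Fin m) ×ˢ K)) :=
    ((isCompact_stdSimplex ℝ _).prod ((isCompact_stdSimplex ℝ _).prod hK)).image
      continuous_ofStrategies
  refine hc.of_isClosed_subset
    (isClosed_N.isClosedEmbedding_subtypeVal.isClosedMap _ (hK.isClosed.preimage continuous_g)) ?_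
  rintro _ ⟨p, hp, rfl⟩
  exact ⟨(p.1.1.1, p.1.2.1, g A (-A) β p), ⟨p.2.1.2, ⟨p.2.2.1.1, p.2.2.1.2.2⟩, hp⟩,
    ofStrategies_eq p⟩

lemma pos_of_nonconstant (hβ : ∃ j k, β j ≠ β k) : 0 < n := by
  obtain ⟨j, -⟩ := hβ
  exact j.pos

theorem g_bijective (hm : 0 < m) (hβ : ∃ j k, β j ≠ β k) (hP : NondegenerateP A)
    (hQ : NondegenerateQ' (-A) β) : Function.Bijective (g A (-A) β) :=
  ⟨g_injective hm hβ hP hQ, g_surjective hm (pos_of_nonconstant hβ)⟩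

/-- The homeomorphism of `ℝ` onto `𝒩` that is inverse to `g`. -/
def path (hg : Function.Bijective (g A (-A) β)) : ℝ ≃ₜ N A (-A) β :=
  ((Equiv.ofBijective _ hg).toHomeomorphOfContinuousClosed continuous_g
    isProperMap_g.isClosedMap).symm

lemma g_path (hg : Function.Bijective (g A (-A) β)) (t : ℝ) : g A (-A) β (path hg t) = t :=
  (Equiv.ofBijective _ hg).apply_symm_apply t

/-! ### The ends of `𝒩` -/

/-- For large `λ` (in the direction `ε`), only columns at which `ε β` is maximal are tight. -/
lemma eventually_tight_columns (A : Matrix (Fin m) (Fin n) ℝ) (β : Fin n → ℝ) (ε : ℝ) :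
    ∀ᶠ s in atTop, ∀ w ∈ Q' (-A) β, w.2.1 = ε * s → ∀ j k,
      slackQ' (-A) β w (Sum.inr j) = 0 → ε * β k ≤ ε * β j := by
  have h : ∀ j k, ∀ᶠ s : ℝ in atTop, ∀ w ∈ Q' (-A) β, w.2.1 = ε * s →
      slackQ' (-A) β w (Sum.inr j) = 0 → ε * β k ≤ ε * β j := by
    intro j k
    rcases le_or_gt (ε * β k) (ε * β j) with hjk | hjk
    · exact Eventually.of_forall fun _ _ _ _ _ => hjk
    have hδ : 0 < ε * β k - ε * β j := sub_pos.2 hjk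
    filter_upwards [eventually_gt_atTop ((∑ i, (|A i k| + |A i j|)) / (ε * β k - ε * β j))]
      with s hs w hw hws hj
    rw [div_lt_iff₀ hδ] at hs
    have hj : w.1 ⬝ᵥ (-A).col j + β j * w.2.1 - w.2.2 = 0 := hj
    have hk := hw.2.1 k
    have hb : w.1 ⬝ᵥ A.col k - w.1 ⬝ᵥ A.col j ≤ ∑ i, (|A i k| + |A i j|) := by
      rw [dotProduct, dotProduct, ← Finset.sum_sub_distrib]
      refine Finset.sum_le_sum fun i _ => ?_
      have h0 := hw.1 i
      have h1 : w.1 i ≤ 1 :=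
        hw.2.2 ▸ Finset.single_le_sum (fun i _ => hw.1 i) (Finset.mem_univ i)
      have h2 : w.1 i * A i k ≤ |A i k| := by nlinarith [le_abs_self (A i k), abs_nonneg (A i k)]
      have h3 : -|A i j| ≤ w.1 i * A i j := by nlinarith [neg_abs_le (A i j), abs_nonneg (A i j)]
      simp only [Matrix.col_apply]
      linarith
    have hneg : ∀ j, w.1 ⬝ᵥ (-A).col j = -(w.1 ⬝ᵥ A.col j) := fun j => by
      simp [dotProduct, Matrix.col_apply]
    rw [hneg, hws] at hj hk
    nlinarith
  simp only [← eventually_all] at h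
  filter_upwards [h] with s hs w hw hws j k
  exact hs j k w hw hws

lemma abs_dotProduct_le {y : Fin n → ℝ} (hy : ∀ j, 0 ≤ y j) (hy1 : ∑ j, y j = 1) :
    |β ⬝ᵥ y| ≤ ∑ j, |β j| := by
  refine (Finset.abs_sum_le_sum_abs _ _).trans (Finset.sum_le_sum fun j _ => ?_)
  have : y j ≤ 1 := hy1 ▸ Finset.single_le_sum (fun j _ => hy j) (Finset.mem_univ j)
  rw [abs_mul, abs_of_nonneg (hy j)]
  exact mul_le_of_le_one_right (abs_nonneg _) this

/-- Both ends (`ε = 1` and `ε = -1`) of `𝒩` lie over a single vertex of `P`. -/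
lemma exists_end_vertex (hm : 0 < m) (hβ : ∃ j k, β j ≠ β k) (hP : NondegenerateP A)
    (hQ : NondegenerateQ' (-A) β) {ε : ℝ} (hε : ε * ε = 1) :
    ∃ v ∈ Set.extremePoints ℝ (P A), (∀ j, v.1 j ≠ 0 → ∀ k, ε * β k ≤ ε * β j) ∧
      ∀ᶠ t in atTop, ∀ p : N A (-A) β, g A (-A) β p = ε * t → p.1.1 = v := by
  have hg := g_bijective hm hβ hP hQ
  have hn := pos_of_nonconstant hβ
  obtain ⟨j₀, hj₀⟩ := (Set.finite_univ (α := Fin n)).exists_maximalFor (fun j => ε * β j) _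
    ⟨⟨0, hn⟩, trivial⟩
  have hmax : ∀ k, ε * β k ≤ ε * β j₀ := fun k =>
    (le_total (ε * β k) (ε * β j₀)).elim id fun h => hj₀.2 trivial h
  have hcancel : ∀ j, ε * β j₀ ≤ ε * β j → β j = β j₀ := fun j hj => by
    have h : ε * β j = ε * β j₀ := le_antisymm (hmax j) hj
    exact mul_left_cancel₀ (left_ne_zero_of_mul_eq_one hε) h
  obtain ⟨K, hK⟩ := eventually_atTop.1 (eventually_tight_columns A β ε)
  -- the structure of points of `𝒩` far out
  have hfar : ∀ t, K + ∑ j, |β j| ≤ t → ∀ p : N A (-A) β, g A (-A) β p = ε * t →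
      (∀ j, slackQ' (-A) β p.1.2 (Sum.inr j) = 0 → β j = β j₀) ∧
      β ⬝ᵥ p.1.1.1 = β j₀ := by
    intro t ht p hp
    -- As `ε` is its own inverse, `λ = ε s` with `s = t - ε βᵀy`, and the summand `∑ |βⱼ|` in the
    -- bound on `t` ensures `K ≤ s`.
    have hlam : p.1.2.2.1 = ε * (t - ε * (β ⬝ᵥ p.1.1.1)) := by
      simp only [g, betaY, lam] at hp
      linear_combination hp + hε * (β ⬝ᵥ p.1.1.1)
    have hb : ε * (β ⬝ᵥ p.1.1.1) ≤ ∑ j, |β j| := by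
      have habs : |ε| = 1 := by
        have h := abs_mul_abs_self ε
        rw [hε] at h
        nlinarith [abs_nonneg ε]
      calc ε * (β ⬝ᵥ p.1.1.1) ≤ |ε * (β ⬝ᵥ p.1.1.1)| := le_abs_self _
        _ = |β ⬝ᵥ p.1.1.1| := by rw [abs_mul, habs, one_mul]
        _ ≤ _ := abs_dotProduct_le p.2.1.2.1 p.2.1.2.2
    have htight : ∀ j, slackQ' (-A) β p.1.2 (Sum.inr j) = 0 → β j = β j₀ := fun j hj =>
      hcancel j (hK _ (by linarith) p.1.2 p.2.2.1 hlam j j₀ hj)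
    refine ⟨htight, ?_⟩
    have h : ∀ j, β j * p.1.1.1 j = β j₀ * p.1.1.1 j := fun j => by
      rcases slack_eq_zero_or p.2 (Sum.inr j) with h | h
      · have h : -p.1.1.1 j = 0 := h
        rw [neg_eq_zero.1 h, mul_zero, mul_zero]
      · rw [htight j h]
    rw [dotProduct, Finset.sum_congr rfl fun j _ => h j, ← Finset.mul_sum, p.2.1.2.2, mul_one]
  set T : ℝ := K + ∑ j, |β j| with hT
  obtain ⟨p, hp⟩ := hg.2 (ε * T)
  obtain ⟨htight, hβy⟩ := hfar T le_rfl p hp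
  obtain ⟨hpP, hpQ, hpgap⟩ := mem_N_iff.1 p.2
  have hvP := mem_P_iff.1 hpP
  have hwQ := mem_Q'_iff.1 hpQ
  have hcard : n ≤ {k | slackP A p.1.1 k = 0}.ncard := by
    refine (card_label_cases hP hQ p.2).resolve_right fun h => ?_
    -- This direction preserves every tight inequality of the `Q'`-point, which therefore is no
    -- vertex; the maximal label count must occur in `P`.
    have h0 : (((0 : Fin m → ℝ), (1 : ℝ), β j₀) : (Fin m → ℝ) × ℝ × ℝ) = 0 := by
      refine eq_zero_of_tight (fun e _ => slackQ'_pointed hβ (-A) e) hQ.ncard_le hwQ.1 hwQ.2 h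
        (by simp [total_apply]) ?_
      rintro (i | j) hk
      · simp [slackQ']
      · simp [slackQ', htight j hk]
    exact one_ne_zero (congrArg (fun w => w.2.1) h0)
  refine ⟨p.1.1, ?_, fun j hj k => ?_, ?_⟩
  · have h := mem_extremePoints_of_tight (fun e _ => slackP_pointed hm A e) hP.ncard_le
      hvP.1 hvP.2 hcard
    have hset : P A = {v | (∀ k, slackP A v k ≤ 0) ∧ total n ℝ v = 1} :=
      Set.ext fun _ => mem_P_iff
    rwa [hset]
  · have hj' : slackP A p.1.1 (Sum.inr j) ≠ 0 := fun h => hj (neg_eq_zero.1 h)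
    rw [htight j ((slack_eq_zero_or p.2 (Sum.inr j)).resolve_left hj')]
    exact hmax k
  · filter_upwards [eventually_ge_atTop T] with t ht q hq
    -- Sliding along that direction keeps the gap zero over the same vertex, and injectivity of `g`
    -- identifies `q` with the resulting point.
    have hN : (p.1.1, (p.1.2.1, p.1.2.2.1 + ε * (t - T),
        p.1.2.2.2 + β j₀ * (ε * (t - T)))) ∈ N A (-A) β := by
      refine mem_N_iff.2 ⟨hpP, ⟨hpQ.1, fun j => ?_, hpQ.2.2⟩, ?_⟩
      · have h1 := hpQ.2.1 j
        have h2 := mul_nonneg (sub_nonneg.2 (hmax j)) (sub_nonneg.2 ht)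
        dsimp only
        linarith
      · dsimp only
        rw [hβy] at hpgap ⊢
        linarith
    have hpq : q = ⟨_, hN⟩ := by
      refine hg.1 ?_
      rw [hq]
      simp only [g, betaY, lam] at hp ⊢
      linear_combination -hp
    rw [hpq]

/-! ### Directed traversals -/

lemma exists_start (hm : 0 < m) (hβ : ∃ j k, β j ≠ β k) (hP : NondegenerateP A)
    (hQ : NondegenerateQ' (-A) β) : ∃ v, IsStartVertex A β v ∧
      ∀ᶠ t in atBot, ∀ p : N A (-A) β, g A (-A) β p = t → p.1.1 = v := by
  obtain ⟨v, hv, hs, ht⟩ := exists_end_vertex hm hβ hP hQ (ε := -1) (by norm_num)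
  refine ⟨v, ⟨hv, fun j hj k => by linarith [hs j hj k]⟩, ?_⟩
  filter_upwards [tendsto_neg_atBot_atTop.eventually ht] with t h p hp
  exact h p (by rw [hp]; ring)

lemma exists_end (hm : 0 < m) (hβ : ∃ j k, β j ≠ β k) (hP : NondegenerateP A)
    (hQ : NondegenerateQ' (-A) β) : ∃ v, IsEndVertex A β v ∧
      ∀ᶠ t in atTop, ∀ p : N A (-A) β, g A (-A) β p = t → p.1.1 = v := by
  obtain ⟨v, hv, hs, ht⟩ := exists_end_vertex hm hβ hP hQ (ε := 1) (by norm_num)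
  refine ⟨v, ⟨hv, fun j hj k => by linarith [hs j hj k]⟩, ?_⟩
  filter_upwards [ht] with t h p hp
  exact h p (by rw [hp]; ring)

lemma isDirectedTraversal_path (hm : 0 < m) (hβ : ∃ j k, β j ≠ β k) (hP : NondegenerateP A)
    (hQ : NondegenerateQ' (-A) β) :
    IsDirectedTraversal A (-A) β (path (g_bijective hm hβ hP hQ)) := by
  have hg := g_bijective hm hβ hP hQ
  obtain ⟨vs, hvs, hs⟩ := exists_start hm hβ hP hQ
  obtain ⟨ve, hve, he⟩ := exists_end hm hβ hP hQ
  refine ⟨⟨vs, hvs, ?_⟩, ⟨ve, hve, ?_⟩⟩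
  · filter_upwards [hs] with t ht
    have h := ht _ (g_path hg t)
    refine ⟨h, ?_⟩
    rw [← h]
    exact (path hg t).2
  · filter_upwards [he] with t ht
    have h := ht _ (g_path hg t)
    refine ⟨h, ?_⟩
    rw [← h]
    exact (path hg t).2

lemma not_isStartVertex_of_isEndVertex (hβ : ∃ j k, β j ≠ β k) {v : (Fin n → ℝ) × ℝ}
    (he : IsEndVertex A β v) : ¬ IsStartVertex A β v := by
  intro hs
  have hsum : ∑ j, v.1 j = 1 := hs.1.1.2.2
  obtain ⟨j, -, hj⟩ := Finset.exists_ne_zero_of_sum_ne_zero (hsum.trans_ne one_ne_zero)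
  obtain ⟨k, l, hkl⟩ := hβ
  have h : ∀ k, β k = β j := fun k => le_antisymm (he.2 j hj k) (hs.2 j hj k)
  exact hkl ((h k).trans (h l).symm)

lemma strictMono_g_comp (hm : 0 < m) (hβ : ∃ j k, β j ≠ β k) (hP : NondegenerateP A)
    (hQ : NondegenerateQ' (-A) β) {φ : ℝ ≃ₜ N A (-A) β} (hφ : IsDirectedTraversal A (-A) β φ) :
    StrictMono (fun t => g A (-A) β (φ t)) := by
  have hg := g_bijective hm hβ hP hQ
  have hc : Continuous (fun t => g A (-A) β (φ t)) := continuous_g.comp φ.continuous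
  have hb : Function.Bijective (fun t => g A (-A) β (φ t)) := hg.comp φ.bijective
  refine (hc.strictMono_of_inj hb.1).resolve_right fun hanti => ?_
  obtain ⟨⟨vs, hvs, hs⟩, -⟩ := hφ
  obtain ⟨ve, hve, he⟩ := exists_end hm hβ hP hQ
  -- Were `g ∘ φ` decreasing, the start of `φ` would lie over an end vertex too, making `β`
  -- constant.
  have hlim : Tendsto (fun t => g A (-A) β (φ t)) atBot atTop :=
    tendsto_atBot_atTop_of_antitone hanti.antitone fun b =>
      (hb.2 b).imp fun _ h => h.ge
  obtain ⟨t, ht, ht'⟩ := (hs.and (hlim.eventually he)).exists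
  have h : (φ t).1.1 = ve := ht' (φ t) rfl
  have h' : (φ t).1.1 = vs := ht.1
  exact not_isStartVertex_of_isEndVertex hβ hve (h.symm.trans h' ▸ hvs)

end GameSpace

end

theorem mainTheorem7 (m n : ℕ) (hm : 0 < m) (A : Matrix (Fin m) (Fin n) ℝ) (β : Fin n → ℝ)
    (hβ : ∃ j k, β j ≠ β k)
    (hP : GameSpace.NondegenerateP A) (hQ : GameSpace.NondegenerateQ' (-A) β) :
    (∃ φ : ℝ ≃ₜ GameSpace.N A (-A) β, GameSpace.IsDirectedTraversal A (-A) β φ) ∧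
    (∀ φ : ℝ ≃ₜ GameSpace.N A (-A) β, GameSpace.IsDirectedTraversal A (-A) β φ →
      Monotone (fun t => GameSpace.betaY A (-A) β (φ t)) ∧
      Monotone (fun t => GameSpace.lam A (-A) β (φ t)) ∧
      StrictMono (fun t => GameSpace.g A (-A) β (φ t)) ∧
      Tendsto (fun t => GameSpace.g A (-A) β (φ t)) atBot atBot ∧
      Tendsto (fun t => GameSpace.g A (-A) β (φ t)) atTop atTop) ∧
    Function.Bijective (GameSpace.g A (-A) β) := by
  have hg := GameSpace.g_bijective hm hβ hP hQ
  refine ⟨⟨_, GameSpace.isDirectedTraversal_path hm hβ hP hQ⟩, fun φ hφ => ?_, hg⟩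
  have hmono := GameSpace.strictMono_g_comp hm hβ hP hQ hφ
  have hsurj : Function.Surjective (fun t => GameSpace.g A (-A) β (φ t)) :=
    hg.2.comp φ.surjective
  exact ⟨fun s t hst => (GameSpace.betaY_le_and_lam_le_of_g_le (hmono.monotone hst)).1,
    fun s t hst => (GameSpace.betaY_le_and_lam_le_of_g_le (hmono.monotone hst)).2, hmono,
    tendsto_atBot_atBot_of_monotone hmono.monotone fun b => (hsurj b).imp fun _ h => h.le,
    tendsto_atTop_atTop_of_monotone hmono.monotone fun b => (hsurj b).imp fun _ h => h.ge⟩
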